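/- Let $p$ be a prime with $p\equiv 3 \pmod 4$ and let $\Delta=4p$, the discriminant of $\mathbb{Q}(\sqrt p)$. Let $\left(\frac{\Delta}{a}\right)$ denote the Kronecker symbol, and let $$F_\Delta(x)=\sum_{a=1}^{4p-1}\left(\frac{\Delta}{a}\right)x^a,\qquad \tilde F_\Delta(x)=\sum_{a=0}^{2p-1}\left(\frac{\Delta}{2a+1}\right)x^a$$ be the generalized Fekete polynomial and the modified Fekete polynomial of $\Delta$, so that $F_\Delta(x)=x\,\tilde F_\Delta(x^2)$. Let $\Phi_n(x)$ be the $n$-th cyclotomic polynomial, and write $r_\Delta(\Phi_n)$ and $\tilde r_\Delta(\Phi_n)$ for the multiplicity of $\Phi_n(x)$ as a factor of $F_\Delta(x)$ and of $\tilde F_\Delta(x)$, respectively. Then $$r_\Delta(\Phi_{12})=\tilde r_\Delta(\Phi_6)=\begin{cases}1 & \text{if } p\equiv 7 \pmod 8,\\ 0 & \text{if } p\equiv 3 \pmod 8.\end{cases}$$ -/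

import Mathlib

open Polynomial

/-- The Kronecker symbol `(a / q)` at a prime `q`: the Legendre symbol if `q` is odd; for `q = 2`
it is `0`, `1`, `-1` according to `a` even, `a ≡ ±1 (mod 8)`, `a ≡ ±3 (mod 8)`. -/
def kroneckerPrime (a : ℤ) (q : ℕ) (hq : q.Prime) : ℤ :=
  if q = 2 then
    if a % 2 = 0 then 0 else if a % 8 = 1 ∨ a % 8 = 7 then 1 else -1
  else
    @legendreSym q ⟨hq⟩ a

/-- The Kronecker symbol `(a / n)`. For `n ≠ 0` it is the factor of the sign of `n` times the
product of `(a / q)` over the prime factors `q` of `|n|`, counted with multiplicity. -/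
def kroneckerSym (a n : ℤ) : ℤ :=
  if n = 0 then
    if a = 1 ∨ a = -1 then 1 else 0
  else
    (if n < 0 ∧ a < 0 then -1 else 1) *
      (n.natAbs.primeFactorsList.pmap (kroneckerPrime a)
        (fun _ h => Nat.prime_of_mem_primeFactorsList h)).prod

/-- The generalized Fekete polynomial `F_Δ(x) = ∑_{a=1}^{|Δ|-1} (Δ / a) x^a`
of a fundamental discriminant `Δ`. -/
noncomputable def feketePoly (Δ : ℤ) : ℤ[X] :=
  ∑ a ∈ Finset.Ico 1 Δ.natAbs, C (kroneckerSym Δ a) * X ^ a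

/-- The modified Fekete polynomial `∑_{a=0}^{|Δ|/2-1} (Δ / (2a+1)) x^a` of an even `Δ`. -/
noncomputable def modifiedFeketePoly (Δ : ℤ) : ℤ[X] :=
  ∑ a ∈ Finset.range (Δ.natAbs / 2), C (kroneckerSym Δ (2 * a + 1)) * X ^ a

/-- `r_Δ(Φ_n)`: the multiplicity of the cyclotomic polynomial `Φ_n` in `F_Δ`. -/
noncomputable def feketeMult (Δ : ℤ) (n : ℕ) : ℕ∞ :=
  emultiplicity (cyclotomic n ℤ) (feketePoly Δ)

/-- The multiplicity of the cyclotomic polynomial `Φ_n` in the modified Fekete polynomial of an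
even `Δ`. -/
noncomputable def modifiedFeketeMult (Δ : ℤ) (n : ℕ) : ℕ∞ :=
  emultiplicity (cyclotomic n ℤ) (modifiedFeketePoly Δ)

theorem kroneckerSym_even_even {a : ℤ} (ha : Even a) {n : ℕ} (hn : n ≠ 0) (h2 : Even n) :
    kroneckerSym a n = 0 := by
  have h : 2 ∈ n.primeFactorsList := by
    rw [Nat.mem_primeFactorsList hn]
    exact ⟨Nat.prime_two, h2.two_dvd⟩
  rw [kroneckerSym, if_neg (by exact_mod_cast hn)]
  refine mul_eq_zero_of_right _ (List.prod_eq_zero ?_)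
  rw [List.mem_pmap]
  refine ⟨2, by simpa using h, ?_⟩
  simp [kroneckerPrime, Int.even_iff.mp ha]

/-- The defining property of the modified polynomial: `F_Δ(x) = x * G(x^2)` for even `Δ`, where
`G` is the modified Fekete polynomial of `Δ`. -/
theorem feketePoly_eq_X_mul_comp {Δ : ℤ} (hΔ : Even Δ) :
    feketePoly Δ = X * (modifiedFeketePoly Δ).comp (X ^ 2) := by
  obtain ⟨m, hm⟩ : ∃ m, Δ.natAbs = 2 * m := (Int.natAbs_even.mpr hΔ).two_dvd
  have key : ∀ k : ℕ, ∑ a ∈ Finset.range (2 * k),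
      (if a = 0 then 0 else C (kroneckerSym Δ a) * X ^ a : ℤ[X]) =
      X * ∑ a ∈ Finset.range k, C (kroneckerSym Δ (2 * a + 1)) * (X ^ 2) ^ a := by
    intro k
    induction k with
    | zero => simp
    | succ k ih =>
      rw [show 2 * (k + 1) = 2 * k + 1 + 1 by ring, Finset.sum_range_succ, Finset.sum_range_succ,
        ih, Finset.sum_range_succ]
      have h0 : (if 2 * k = 0 then 0 else
          C (kroneckerSym Δ ((2 * k : ℕ) : ℤ)) * X ^ (2 * k) : ℤ[X]) = 0 := by
        split_ifs with h
        · rfl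
        · rw [kroneckerSym_even_even hΔ h (even_two_mul k)]
          simp
      rw [h0, if_neg (by omega)]
      push_cast
      ring
  rw [feketePoly, modifiedFeketePoly, hm, Nat.mul_div_cancel_left _ two_pos,
    ← coe_compRingHom_apply, map_sum]
  simp only [coe_compRingHom_apply, mul_comp, C_comp, pow_comp, X_comp]
  rw [← key, Finset.range_eq_Ico]
  refine Finset.sum_subset_zero_on_sdiff (Finset.Ico_subset_Ico_left zero_le_one) ?_ ?_
  · intro a ha
    simp only [Finset.mem_sdiff, Finset.mem_Ico, not_and, not_lt] at ha
    rw [if_pos (by omega)]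
  · intro a ha
    rw [if_neg (by have := (Finset.mem_Ico.mp ha).1; omega)]

/-! Let χ be the quadratic character mod p, which is odd. Reciprocity gives (4p / 2a+1) = (-1)^a
χ(2a+1), so the modified Fekete polynomial is (1 - X^p) h with h = `halfFeketePoly p`. Since 6 does
not divide p, only the multiplicity of Φ_6 in h matters.

At ζ = -y, with y a primitive cube root of unity, the signs cancel and h(ζ) = ∑ χ(2x+1) y^x. The
substitution x = 3c + (p-1)/2 turns 2x+1 into 6c and makes y^x depend only on the sixth of [0, p)
containing c. Let I_j and J_j be the sums of χ(c) and χ(c)c over the j-th sixth. For p > 3, h(ζ) is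
a nonzero multiple of I_1 + I_2, hence of (χ(2) - 1)H with H = ∑ χ(x)x odd (`sextantSum_relations`,
`sum_quadraticChar_mul_val_odd`). It vanishes exactly when χ(2) = 1, that is, p ≡ 7 (mod 8).

In that case ζh'(ζ) is a nonzero multiple of J_0. The Fourier series of the second Bernoulli
polynomial expresses J_0 as a nonzero multiple of ∑ χ(n) sin(nπ/3)/n², whose first term √3/2 exceeds
the bound π²/6 - 1 on all the others. So the root is simple. -/

/-! ### Reduction of the Kronecker symbol to the quadratic character -/

theorem kroneckerSym_natCast_of_odd (a : ℤ) {n : ℕ} (hn : Odd n) :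
    kroneckerSym a n = jacobiSym a n := by
  have h0 : n ≠ 0 := by rintro rfl; simp at hn
  rw [kroneckerSym, if_neg (by exact_mod_cast h0), if_neg (by omega), one_mul, jacobiSym]
  simp only [Int.natAbs_natCast]
  congr 1
  refine List.pmap_congr_left _ fun q hq h₁ h₂ => ?_
  rw [kroneckerPrime, if_neg]
  rintro rfl
  exact (Nat.not_even_iff_odd.mpr hn) (even_iff_two_dvd.mpr (Nat.dvd_of_mem_primeFactorsList hq))

theorem kroneckerSym_four_mul_prime {p : ℕ} [Fact p.Prime] (hp : p % 4 = 3) (a : ℕ) :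
    kroneckerSym (4 * (p : ℤ)) (2 * a + 1) =
      (-1) ^ a * quadraticChar (ZMod p) (2 * (a : ZMod p) + 1) := by
  have hodd : Odd (2 * a + 1) := odd_two_mul_add_one a
  have hpo : Odd p := Nat.odd_iff.mpr (by omega)
  have h := kroneckerSym_natCast_of_odd (4 * (p : ℤ)) hodd
  push_cast at h
  -- The factor 4 contributes (2/n)² = 1 for odd n; reciprocity gives the sign (-1)^(a(p-1)/2) =
  -- (-1)^a, as (p-1)/2 is odd.
  rw [h, show (4 : ℤ) * p = 2 * (2 * p) by ring, jacobiSym.mul_left, jacobiSym.mul_left,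
    ← mul_assoc, ← sq, jacobiSym.sq_one, one_mul, jacobiSym.quadratic_reciprocity hpo hodd,
    ← jacobiSym.legendreSym.to_jacobiSym, show (2 * a + 1) / 2 = a by omega, pow_mul,
    Odd.neg_one_pow (Nat.odd_iff.mpr (by omega))]
  · simp [legendreSym]
  · rw [Int.gcd_eq_natAbs]
    simp

/-- For `p ≡ 3 (mod 4)` the quadratic character is odd. -/
theorem quadraticChar_neg {p : ℕ} [Fact p.Prime] (hp : p % 4 = 3) (x : ZMod p) :
    quadraticChar (ZMod p) (-x) = -quadraticChar (ZMod p) x := by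
  have h : quadraticChar (ZMod p) (-1) = -1 := by
    rw [quadraticChar_neg_one (by rw [ZMod.ringChar_zmod_n]; omega), ZMod.card,
      ZMod.χ₄_nat_three_mod_four hp]
  rw [← neg_one_mul, map_mul, h, neg_one_mul]

/-! ### The sum H = ∑ χ(x)x -/

/-- Mod 2 the values ±1 of χ agree, so the sum reduces to 0 + 1 + ... + (p-1) = p(p-1)/2. Used to
get H ≠ 0. -/
theorem sum_quadraticChar_mul_val_odd {p : ℕ} [Fact p.Prime] (hp : p % 4 = 3) :
    Odd (∑ x : ZMod p, quadraticChar (ZMod p) x * (x.val : ℤ)) := by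
  have h2 : ((∑ x : ZMod p, quadraticChar (ZMod p) x * (x.val : ℤ) : ℤ) : ZMod 2) =
      ((∑ i ∈ Finset.range p, i : ℕ) : ZMod 2) := by
    have : ∑ i ∈ Finset.range p, i = ∑ x : ZMod p, x.val := by
      obtain ⟨k, rfl⟩ : ∃ k, p = k + 1 := ⟨p - 1, by omega⟩
      exact Finset.sum_range _
    rw [this]
    push_cast
    refine Finset.sum_congr rfl fun x _ => ?_
    rcases eq_or_ne x 0 with rfl | hx
    · simp
    · rcases quadraticChar_dichotomy hx with h | h <;> rw [h] <;> simp
  rw [← ZMod.intCast_eq_one_iff_odd, h2, ZMod.natCast_eq_one_iff_odd, Finset.sum_range_id]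
  rw [show p * (p - 1) / 2 = p * ((p - 1) / 2) from Nat.mul_div_assoc _ (by omega), Nat.odd_mul]
  constructor <;> rw [Nat.odd_iff] <;> omega

/-- Substitute x ↦ kx and write the residue of kx as kx - p⌊kx/p⌋. -/
theorem sum_quadraticChar_mul_val_eq {p : ℕ} [Fact p.Prime] {k : ℕ} (hk : (k : ZMod p) ≠ 0) :
    ∑ x : ZMod p, quadraticChar (ZMod p) x * (x.val : ℤ) =
      quadraticChar (ZMod p) k * (k * ∑ x : ZMod p, quadraticChar (ZMod p) x * (x.val : ℤ) -
        p * ∑ x : ZMod p, quadraticChar (ZMod p) x * ((k * x.val / p : ℕ) : ℤ)) := by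
  conv_lhs => rw [← Equiv.sum_comp (Equiv.mulLeft₀ (k : ZMod p) hk)]
  simp only [Finset.mul_sum, ← Finset.sum_sub_distrib, Equiv.mulLeft₀_apply, map_mul]
  refine Finset.sum_congr rfl fun x _ => ?_
  have h : (((k : ZMod p) * x).val : ℤ) = k * x.val - p * ((k * x.val / p : ℕ) : ℤ) := by
    have h1 : ((k : ZMod p) * x).val = k * x.val % p := by
      rw [← ZMod.val_natCast, Nat.cast_mul, ZMod.natCast_zmod_val]
    have h2 := Nat.mod_add_div (k * x.val) p
    rw [h1]
    zify at h2 ⊢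
    linarith
  rw [h]
  ring

/-! ### Sums over sixths of the residues -/

/-- The sum of `f` over the residues whose representative lies in the `j`-th sixth of `[0, p)`. -/
def sextantSum (p : ℕ) [NeZero p] (f : ZMod p → ℤ) (j : ℕ) : ℤ :=
  ∑ x with 6 * x.val / p = j, f x

theorem sextant_lt {p : ℕ} [NeZero p] (x : ZMod p) : 6 * x.val / p < 6 := by
  rw [Nat.div_lt_iff_lt_mul (NeZero.pos p)]
  have := ZMod.val_lt x
  omega

theorem sum_mul_sextant {R : Type*} [CommRing R] {p : ℕ} [NeZero p] (f : ZMod p → ℤ) (g : ℕ → R) :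
    ∑ x : ZMod p, (f x : R) * g (6 * x.val / p) =
      ∑ j ∈ Finset.range 6, g j * (sextantSum p f j : R) := by
  rw [← Finset.sum_fiberwise_of_maps_to (s := Finset.univ) (t := Finset.range 6)
    (g := fun x : ZMod p => 6 * x.val / p) (fun x _ => Finset.mem_range.mpr (sextant_lt x))]
  refine Finset.sum_congr rfl fun j _ => ?_
  rw [sextantSum, Int.cast_sum, Finset.mul_sum]
  refine Finset.sum_congr rfl fun x hx => ?_
  rw [(Finset.mem_filter.mp hx).2, mul_comm]

theorem sextant_not_dvd {p : ℕ} [Fact p.Prime] (hp : 3 < p) {x : ZMod p} (hx : x ≠ 0) :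
    ¬ p ∣ 6 * x.val := by
  rw [(Fact.out : p.Prime).dvd_mul, show 6 = 2 * 3 from rfl, (Fact.out : p.Prime).dvd_mul]
  rintro ((h | h) | h)
  · exact absurd (Nat.le_of_dvd (by norm_num) h) (by omega)
  · exact absurd (Nat.le_of_dvd (by norm_num) h) (by omega)
  · have h1 := Nat.le_of_dvd (Nat.pos_of_ne_zero ((ZMod.val_ne_zero x).mpr hx)) h
    have := ZMod.val_lt x
    omega

theorem sextant_neg {p : ℕ} [Fact p.Prime] (hp : 3 < p) {x : ZMod p} (hx : x ≠ 0) :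
    6 * (-x).val / p = 5 - 6 * x.val / p := by
  have : NeZero x := ⟨hx⟩
  have h0 : 0 < p := by omega
  have hlt := ZMod.val_lt x
  have h6 := sextant_lt x
  have hd := Nat.div_add_mod (6 * x.val) p
  have hm := Nat.mod_lt (6 * x.val) h0
  have hmp : 0 < 6 * x.val % p :=
    Nat.pos_of_ne_zero fun h => sextant_not_dvd hp hx (Nat.dvd_of_mod_eq_zero h)
  rw [ZMod.val_neg_of_ne_zero]
  generalize 6 * x.val / p = q at *
  rw [Nat.div_eq_iff h0]
  interval_cases q <;> omega

theorem sextantSum_reflect {p : ℕ} [Fact p.Prime] (hp : 3 < p) {f g : ZMod p → ℤ}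
    (hf : f 0 = 0) (hg : g 0 = 0) (h : ∀ x ≠ 0, f (-x) = g x) {j : ℕ} (hj : j < 6) :
    sextantSum p f (5 - j) = sextantSum p g j := by
  simp only [sextantSum, Finset.sum_filter]
  rw [← Equiv.sum_comp (Equiv.neg (ZMod p))]
  refine Finset.sum_congr rfl fun x _ => ?_
  rw [Equiv.neg_apply]
  rcases eq_or_ne x 0 with rfl | hx
  · simp [hf, hg]
  · rw [sextant_neg hp hx, h x hx]
    have := sextant_lt x
    exact if_congr (by omega) rfl rfl

theorem sextantSum_quadraticChar_reflect {p : ℕ} [Fact p.Prime] (hp : 3 < p) (hp4 : p % 4 = 3)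
    {j : ℕ} (hj : j < 6) :
    sextantSum p (quadraticChar (ZMod p)) (5 - j) =
      -sextantSum p (quadraticChar (ZMod p)) j := by
  rw [sextantSum_reflect hp (g := fun x => -quadraticChar (ZMod p) x) (by simp) (by simp)
    (fun x _ => quadraticChar_neg hp4 x) hj]
  simp [sextantSum]

theorem sextantSum_quadraticChar_mul_val_reflect {p : ℕ} [Fact p.Prime] (hp : 3 < p)
    (hp4 : p % 4 = 3) {j : ℕ} (hj : j < 6) :
    sextantSum p (fun x => quadraticChar (ZMod p) x * x.val) (5 - j) =
      sextantSum p (fun x => quadraticChar (ZMod p) x * x.val) j -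
        p * sextantSum p (quadraticChar (ZMod p)) j := by
  rw [sextantSum_reflect hp (g := fun x => quadraticChar (ZMod p) x * x.val -
    p * quadraticChar (ZMod p) x) (by simp) (by simp) ?_ hj]
  · simp [sextantSum, Finset.sum_sub_distrib, Finset.mul_sum]
  · intro x hx
    have : NeZero x := ⟨hx⟩
    rw [quadraticChar_neg hp4, ZMod.val_neg_of_ne_zero, Nat.cast_sub (ZMod.val_lt x).le]
    ring

theorem natCast_two_three_ne_zero {p : ℕ} [Fact p.Prime] (hp : 3 < p) :
    ((2 : ℕ) : ZMod p) ≠ 0 ∧ ((3 : ℕ) : ZMod p) ≠ 0 := by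
  constructor <;> rw [Ne, ZMod.natCast_eq_zero_iff] <;> intro h <;>
    exact absurd (Nat.le_of_dvd (by norm_num) h) (by omega)

/-- For k = 2, 3, 6 the floor ⌊kx/p⌋ is a function of the sixth containing x, so
`sum_quadraticChar_mul_val_eq` gives three linear equations between H and the I_j. Reflection
I_{5-j} = -I_j leaves the unknowns I_0, I_1, I_2, and the system is solved for each choice of signs
χ(2), χ(3). -/
theorem sextantSum_relations {p : ℕ} [Fact p.Prime] (hp : 3 < p) (hp4 : p % 4 = 3) {H : ℤ}
    (hH : H = ∑ x : ZMod p, quadraticChar (ZMod p) x * (x.val : ℤ)) {I : ℕ → ℤ}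
    (hI : I = sextantSum p (quadraticChar (ZMod p))) :
    p * (I 0 + I 1 + I 2) = (quadraticChar (ZMod p) 2 - 2) * H ∧
    2 * (p * (I 1 + I 2)) =
      (3 - quadraticChar (ZMod p) 3) * (quadraticChar (ZMod p) 2 - 1) * H := by
  obtain ⟨h2, h3⟩ := natCast_two_three_ne_zero hp
  have h6 : ((6 : ℕ) : ZMod p) ≠ 0 := by
    rw [show 6 = 2 * 3 from rfl, Nat.cast_mul]; exact mul_ne_zero h2 h3
  have r0 := sextantSum_quadraticChar_reflect hp hp4 (j := 0) (by norm_num)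
  have r1 := sextantSum_quadraticChar_reflect hp hp4 (j := 1) (by norm_num)
  have r2 := sextantSum_quadraticChar_reflect hp hp4 (j := 2) (by norm_num)
  have e2 := sum_quadraticChar_mul_val_eq h2
  have e3 := sum_quadraticChar_mul_val_eq h3
  have e6 := sum_quadraticChar_mul_val_eq h6
  have d2 (x : ZMod p) : 2 * x.val / p = (6 * x.val / p) / 3 := by
    rw [Nat.div_div_eq_div_mul, show 6 * x.val = 2 * x.val * 3 by ring,
      Nat.mul_div_mul_right _ _ (by norm_num)]
  have d3 (x : ZMod p) : 3 * x.val / p = (6 * x.val / p) / 2 := by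
    rw [Nat.div_div_eq_div_mul, show 6 * x.val = 3 * x.val * 2 by ring,
      Nat.mul_div_mul_right _ _ (by norm_num)]
  have s2 := sum_mul_sextant (R := ℤ) (p := p) (quadraticChar (ZMod p)) (fun j => ((j / 3 : ℕ) : ℤ))
  have s3 := sum_mul_sextant (R := ℤ) (p := p) (quadraticChar (ZMod p)) (fun j => ((j / 2 : ℕ) : ℤ))
  have s6 := sum_mul_sextant (R := ℤ) (p := p) (quadraticChar (ZMod p)) (fun j => (j : ℤ))
  simp only [d2] at e2
  simp only [d3] at e3
  simp only [Int.cast_id] at s2 s3 s6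
  have c6 : quadraticChar (ZMod p) ((6 : ℕ) : ZMod p) =
      quadraticChar (ZMod p) 2 * quadraticChar (ZMod p) 3 := by
    rw [← map_mul]; congr 1; norm_num
  have q2 := quadraticChar_dichotomy h2
  have q3 := quadraticChar_dichotomy h3
  rw [s2, ← hH] at e2
  rw [s3, ← hH] at e3
  rw [s6, ← hH, c6] at e6
  simp only [← hI] at e2 e3 e6 r0 r1 r2
  rw [Nat.cast_ofNat] at q2 q3
  simp only [Nat.cast_ofNat] at e2 e3 e6
  generalize quadraticChar (ZMod p) 2 = a at *
  generalize quadraticChar (ZMod p) 3 = b at *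
  norm_num [Finset.sum_range_succ] at e2 e3 e6 r0 r1 r2
  rw [r0, r1, r2] at e2 e3 e6
  rcases q2 with rfl | rfl <;> rcases q3 with rfl | rfl <;> constructor <;> linarith

/-! ### Fourier series and the non-vanishing of J_0 -/

theorem hasSum_cos_div_sq {x : ℝ} (hx : x ∈ Set.Icc (0 : ℝ) 1) :
    HasSum (fun n : ℕ => 1 / (n : ℝ) ^ 2 * Real.cos (2 * Real.pi * n * x))
      (Real.pi ^ 2 * (x ^ 2 - x + 1 / 6)) := by
  have h := hasSum_one_div_nat_pow_mul_cos (k := 1) one_ne_zero hx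
  convert h using 1
  have e : ((Polynomial.bernoulli 2).map (algebraMap ℚ ℝ)).eval x = x ^ 2 - x + 1 / 6 := by
    rw [Polynomial.bernoulli_def]
    simp [Finset.sum_range_succ, bernoulli_two, Polynomial.eval_monomial,
      Polynomial.map_monomial]
    ring
  have f : (((2 * 1).factorial : ℕ) : ℝ) = 2 := by norm_num [Nat.factorial]
  rw [e, f]
  ring

/-- With t = x/p, the point t + 1/6 leaves [0, 1] only when x is in the last sixth; evaluating at t
- 5/6 instead adds the correction 5/3 - 2t. This is how the sums over a single sixth enter. -/
theorem hasSum_cos_div_sq_shift {p : ℕ} [NeZero p] (x : ZMod p) :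
    HasSum (fun n : ℕ => 1 / (n : ℝ) ^ 2 * Real.cos (2 * Real.pi * n * (x.val / p + 1 / 6)))
      (Real.pi ^ 2 * ((x.val / p : ℝ) ^ 2 - x.val / p + x.val / p / 3 + 1 / 36 +
        if 6 * x.val / p = 5 then 5 / 3 - 2 * (x.val / p : ℝ) else 0)) := by
  have hp : (0 : ℝ) < p := by exact_mod_cast NeZero.pos p
  have h0 : (0 : ℝ) ≤ x.val / p := by positivity
  have h1 : (x.val / p : ℝ) < 1 := by
    rw [div_lt_one hp]; exact_mod_cast ZMod.val_lt x
  split_ifs with hq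
  · have h5 : (5 / 6 : ℝ) ≤ x.val / p := by
      rw [le_div_iff₀ hp]
      have : 5 * p ≤ 6 * x.val := by rw [← hq]; exact Nat.div_mul_le_self _ _
      have : (5 * p : ℝ) ≤ 6 * x.val := by exact_mod_cast this
      linarith
    have h := hasSum_cos_div_sq (x := (x.val / p : ℝ) + 1 / 6 - 1) ⟨by linarith, by linarith⟩
    convert h using 1
    · ext n
      rw [show 2 * Real.pi * n * ((x.val / p : ℝ) + 1 / 6 - 1) =
        2 * Real.pi * n * (x.val / p + 1 / 6) - n * (2 * Real.pi) by ring,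
        Real.cos_sub_nat_mul_two_pi]
    · ring
  · have h5 : (x.val / p : ℝ) ≤ 5 / 6 := by
      rw [div_le_iff₀ hp]
      have : 6 * x.val < 5 * p := by
        have := sextant_lt x
        rw [← Nat.div_lt_iff_lt_mul (NeZero.pos p)]
        omega
      have : (6 * x.val : ℝ) < 5 * p := by exact_mod_cast this
      linarith
    convert hasSum_cos_div_sq (x := (x.val / p : ℝ) + 1 / 6) ⟨by linarith, by linarith⟩ using 1
    ring

theorem sum_eq_zero_of_forall_neg {G : Type*} [AddGroup G] [Fintype G] {f : G → ℝ}
    (h : ∀ x, f (-x) = -f x) : ∑ x, f x = 0 := by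
  have := Equiv.sum_comp (Equiv.neg G) f
  simp only [Equiv.neg_apply, h, Finset.sum_neg_distrib] at this
  linarith

theorem val_neg_div {p : ℕ} [NeZero p] {x : ZMod p} (hx : x ≠ 0) :
    ((-x).val / p : ℝ) = 1 - x.val / p := by
  have : NeZero x := ⟨hx⟩
  have hp : (p : ℝ) ≠ 0 := NeZero.ne _
  rw [ZMod.val_neg_of_ne_zero, Nat.cast_sub (ZMod.val_lt x).le]
  field_simp

theorem sum_quadraticChar_mul_eq_zero {p : ℕ} [Fact p.Prime] (hp : p % 4 = 3) {f : ℝ → ℝ}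
    (hf : ∀ t, f (1 - t) = f t) :
    ∑ x : ZMod p, (quadraticChar (ZMod p) x : ℝ) * f (x.val / p) = 0 := by
  refine sum_eq_zero_of_forall_neg fun x => ?_
  rcases eq_or_ne x 0 with rfl | hx
  · simp
  · rw [quadraticChar_neg hp, val_neg_div hx, hf]
    push_cast
    ring

/-- The imaginary part of the quadratic Gauss sum. -/
noncomputable def sineGaussSum (p : ℕ) [Fact p.Prime] : ℝ :=
  ∑ x : ZMod p, (quadraticChar (ZMod p) x : ℝ) * Real.sin (2 * Real.pi * (x.val / p))

theorem sum_quadraticChar_mul_cos {p : ℕ} [Fact p.Prime] (hp : p % 4 = 3) (n : ℕ) :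
    ∑ x : ZMod p, (quadraticChar (ZMod p) x : ℝ) * Real.cos (2 * Real.pi * n * (x.val / p)) = 0 :=
  sum_quadraticChar_mul_eq_zero hp (f := fun t => Real.cos (2 * Real.pi * n * t)) fun t => by
    rw [show 2 * Real.pi * n * (1 - t) = n * (2 * Real.pi) - 2 * Real.pi * n * t by ring,
      Real.cos_nat_mul_two_pi_sub]

theorem sum_quadraticChar_mul_sin {p : ℕ} [Fact p.Prime] (n : ℕ) :
    ∑ x : ZMod p, (quadraticChar (ZMod p) x : ℝ) * Real.sin (2 * Real.pi * n * (x.val / p)) =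
      quadraticChar (ZMod p) n * sineGaussSum p := by
  have hp0 : (p : ℝ) ≠ 0 := NeZero.ne _
  have key (x : ZMod p) : Real.sin (2 * Real.pi * (((n : ZMod p) * x).val / p)) =
      Real.sin (2 * Real.pi * n * (x.val / p)) := by
    have h1 : ((n : ZMod p) * x).val = n * x.val % p := by
      rw [← ZMod.val_natCast, Nat.cast_mul, ZMod.natCast_zmod_val]
    have h2 : ((n * x.val % p : ℕ) : ℝ) + p * (n * x.val / p : ℕ) = n * x.val := by
      exact_mod_cast Nat.mod_add_div (n * x.val) p
    rw [h1, ← Real.sin_add_nat_mul_two_pi _ (n * x.val / p)]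
    refine congrArg Real.sin ?_
    field_simp
    linear_combination h2
  by_cases hn : (n : ZMod p) = 0
  · rw [hn, MulChar.map_zero, Int.cast_zero, zero_mul]
    refine Finset.sum_eq_zero fun x _ => ?_
    rw [← key, hn]
    simp
  · rw [sineGaussSum, ← Equiv.sum_comp (Equiv.mulLeft₀ (n : ZMod p) hn) fun x =>
      (quadraticChar (ZMod p) x : ℝ) * Real.sin (2 * Real.pi * (x.val / p)), Finset.mul_sum]
    refine Finset.sum_congr rfl fun x _ => ?_
    rw [Equiv.mulLeft₀_apply, key, map_mul]
    have : (quadraticChar (ZMod p) n : ℝ) ^ 2 = 1 := by exact_mod_cast quadraticChar_sq_one hn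
    push_cast
    linear_combination -(quadraticChar (ZMod p) x * Real.sin (2 * Real.pi * n * (x.val / p))) * this

/-- The cosine part of the Gauss sum vanishes because χ is odd, while the square of the Gauss sum is
χ(-1)p ≠ 0. -/
theorem sineGaussSum_ne_zero {p : ℕ} [Fact p.Prime] (hp : p % 4 = 3) : sineGaussSum p ≠ 0 := by
  intro h0
  have h2 : ringChar (ZMod p) ≠ 2 := by rw [ZMod.ringChar_zmod_n]; omega
  have hinj : Function.Injective (Int.castRingHom ℂ) := Int.cast_injective
  have hne : (quadraticChar (ZMod p)).ringHomComp (Int.castRingHom ℂ) ≠ 1 :=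
    (MulChar.ringHomComp_ne_one_iff hinj).mpr (quadraticChar_ne_one h2)
  have hsq := gaussSum_sq hne ((quadraticChar_isQuadratic (ZMod p)).comp _)
    (ZMod.isPrimitive_stdAddChar p)
  have hg : gaussSum ((quadraticChar (ZMod p)).ringHomComp (Int.castRingHom ℂ))
      (ZMod.stdAddChar (N := p)) = 0 := by
    have hc := sum_quadraticChar_mul_cos hp 1
    rw [sineGaussSum] at h0
    apply_fun ((↑) : ℝ → ℂ) at h0 hc
    push_cast at h0 hc
    have : gaussSum ((quadraticChar (ZMod p)).ringHomComp (Int.castRingHom ℂ))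
      (ZMod.stdAddChar (N := p)) =
        ∑ x : ZMod p, (quadraticChar (ZMod p) x : ℂ) *
          Complex.cos (2 * Real.pi * 1 * (x.val / p)) +
        (∑ x : ZMod p, (quadraticChar (ZMod p) x : ℂ) *
          Complex.sin (2 * Real.pi * (x.val / p))) * Complex.I := by
      rw [gaussSum, Finset.sum_mul, ← Finset.sum_add_distrib]
      refine Finset.sum_congr rfl fun x _ => ?_
      rw [ZMod.stdAddChar_apply, ZMod.toCircle_apply,
        show 2 * (Real.pi : ℂ) * Complex.I * x.val / p =
          (2 * Real.pi * (x.val / p)) * Complex.I by ring, Complex.exp_mul_I,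
        MulChar.ringHomComp_apply, eq_intCast, mul_one]
      ring
    rw [this, hc, h0, zero_mul, add_zero]
  rw [hg, MulChar.ringHomComp_apply, ZMod.card, quadraticChar_neg hp] at hsq
  have hp0 : p ≠ 0 := NeZero.ne _
  simp [hp0] at hsq

theorem sum_quadraticChar_mul_cos_shift {p : ℕ} [Fact p.Prime] (hp : p % 4 = 3) (n : ℕ) :
    ∑ x : ZMod p, (quadraticChar (ZMod p) x : ℝ) *
      (1 / (n : ℝ) ^ 2 * Real.cos (2 * Real.pi * n * (x.val / p + 1 / 6))) =
    quadraticChar (ZMod p) n * Real.sin (n * (Real.pi / 3)) / n ^ 2 * -sineGaussSum p := by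
  have h1 := sum_quadraticChar_mul_cos hp n
  have h2 := sum_quadraticChar_mul_sin (p := p) n
  have : ∀ x : ZMod p, (quadraticChar (ZMod p) x : ℝ) *
      (1 / (n : ℝ) ^ 2 * Real.cos (2 * Real.pi * n * (x.val / p + 1 / 6))) =
      1 / (n : ℝ) ^ 2 * Real.cos (n * (Real.pi / 3)) *
        (quadraticChar (ZMod p) x * Real.cos (2 * Real.pi * n * (x.val / p))) -
      1 / (n : ℝ) ^ 2 * Real.sin (n * (Real.pi / 3)) *
        (quadraticChar (ZMod p) x * Real.sin (2 * Real.pi * n * (x.val / p))) := by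
    intro x
    rw [show 2 * Real.pi * n * ((x.val : ℝ) / p + 1 / 6) =
      2 * Real.pi * n * (x.val / p) + n * (Real.pi / 3) by ring, Real.cos_add]
    ring
  simp only [this, Finset.sum_sub_distrib, ← Finset.mul_sum, h1, h2]
  ring

theorem not_hasSum_quadraticChar_mul_sin {p : ℕ} [Fact p.Prime] :
    ¬ HasSum (fun n : ℕ => (quadraticChar (ZMod p) n : ℝ) * Real.sin (n * (Real.pi / 3)) / n ^ 2)
      0 := by
  intro h
  -- Adding ∑ 1/n² makes every term nonnegative, so the term n = 1 would satisfy √3/2 + 1 ≤ π²/6,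
  -- which is false.
  have hs := h.add hasSum_zeta_two
  have hle := le_hasSum hs 1 fun n _ => by
    have hb : |(quadraticChar (ZMod p) n : ℝ) * Real.sin (n * (Real.pi / 3))| ≤ 1 := by
      rw [abs_mul]
      refine mul_le_one₀ ?_ (abs_nonneg _) (Real.abs_sin_le_one _)
      rcases (quadraticChar_isQuadratic (ZMod p)) n with h | h | h <;> rw [h] <;> simp
    rw [← add_div]
    have := (abs_le.mp hb).1
    exact div_nonneg (by linarith) (by positivity)
  simp only [Nat.cast_one, map_one, Int.cast_one, one_mul, Real.sin_pi_div_three, one_pow,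
    div_one, zero_add] at hle
  have h3 : (1.7 : ℝ) < √3 := Real.lt_sqrt_of_sq_lt (by norm_num)
  nlinarith [Real.pi_lt_d2, Real.pi_pos]

theorem sextantSum_quadraticChar_mul_val_zero_ne_zero {p : ℕ} [Fact p.Prime] (hp : 3 < p)
    (hp4 : p % 4 = 3)
    (h : p * sextantSum p (quadraticChar (ZMod p)) 0 =
      -∑ x : ZMod p, quadraticChar (ZMod p) x * (x.val : ℤ)) :
    sextantSum p (fun x => quadraticChar (ZMod p) x * x.val) 0 ≠ 0 := by
  intro hJ
  have hp0 : (p : ℝ) ≠ 0 := NeZero.ne _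
  have r0 := sextantSum_quadraticChar_reflect hp hp4 (j := 0) (by norm_num)
  have r1 := sextantSum_quadraticChar_mul_val_reflect hp hp4 (j := 0) (by norm_num)
  rw [hJ] at r1
  have hs := hasSum_sum (s := Finset.univ) fun (x : ZMod p) _ =>
    (hasSum_cos_div_sq_shift x).mul_left (quadraticChar (ZMod p) x : ℝ)
  simp only [sum_quadraticChar_mul_cos_shift hp4] at hs
  have hval : ∑ x : ZMod p, (quadraticChar (ZMod p) x : ℝ) *
      (Real.pi ^ 2 * ((x.val / p : ℝ) ^ 2 - x.val / p + x.val / p / 3 + 1 / 36 +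
        if 6 * x.val / p = 5 then 5 / 3 - 2 * (x.val / p : ℝ) else 0)) = 0 := by
    -- This part is symmetric under t ↦ 1 - t. What remains is H/(3p) + (5/3)I_5 - (2/p)J_5, which
    -- is zero once J_0 = 0 and pI_0 = -H.
    have e1 := sum_quadraticChar_mul_eq_zero hp4 (f := fun t => t ^ 2 - t + 1 / 36)
      fun t => by ring
    have e2 : ∑ x : ZMod p, (quadraticChar (ZMod p) x : ℝ) *
        (if 6 * x.val / p = 5 then 5 / 3 - 2 * (x.val / p : ℝ) else 0) =
        5 / 3 * (sextantSum p (quadraticChar (ZMod p)) 5 : ℝ) - 2 / p *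
          (sextantSum p (fun x => quadraticChar (ZMod p) x * x.val) 5 : ℝ) := by
      simp only [sextantSum, Finset.sum_filter, Int.cast_sum, Finset.mul_sum,
        ← Finset.sum_sub_distrib]
      refine Finset.sum_congr rfl fun x _ => ?_
      split_ifs
      · push_cast; ring
      · simp
    have e3 : ∑ x : ZMod p, (quadraticChar (ZMod p) x : ℝ) * (x.val / p / 3) =
        1 / (3 * p) * ((∑ x : ZMod p, quadraticChar (ZMod p) x * (x.val : ℤ) : ℤ) : ℝ) := by
      push_cast
      rw [Finset.mul_sum]
      refine Finset.sum_congr rfl fun x _ => ?_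
      field_simp
    have e4 := congrArg (fun z : ℤ => (z : ℝ)) h
    have e5 := congrArg (fun z : ℤ => (z : ℝ)) r0
    have e6 := congrArg (fun z : ℤ => (z : ℝ)) r1
    simp only [Int.cast_mul, Int.cast_neg, Int.cast_sub, Int.cast_zero, Int.cast_natCast,
      Nat.sub_zero] at e4 e5 e6
    have : ∀ x : ZMod p, (quadraticChar (ZMod p) x : ℝ) *
      (Real.pi ^ 2 * ((x.val / p : ℝ) ^ 2 - x.val / p + x.val / p / 3 + 1 / 36 +
        if 6 * x.val / p = 5 then 5 / 3 - 2 * (x.val / p : ℝ) else 0)) =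
        Real.pi ^ 2 * (quadraticChar (ZMod p) x *
          ((x.val / p : ℝ) ^ 2 - x.val / p + 1 / 36) +
          quadraticChar (ZMod p) x * (x.val / p / 3) + quadraticChar (ZMod p) x *
          (if 6 * x.val / p = 5 then 5 / 3 - 2 * (x.val / p : ℝ) else 0)) := fun x => by ring
    simp only [this, ← Finset.mul_sum, Finset.sum_add_distrib]
    rw [e1, e2, e3, e5, e6, ← neg_eq_iff_eq_neg.mpr e4]
    field_simp
    ring
  rw [hval] at hs
  have hτ : -sineGaussSum p ≠ 0 := neg_ne_zero.mpr (sineGaussSum_ne_zero hp4)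
  refine not_hasSum_quadraticChar_mul_sin (p := p) ?_
  have := hs.mul_right (-sineGaussSum p)⁻¹
  simpa only [mul_inv_cancel_right₀ hτ, zero_mul] using this

/-! ### Evaluation at cube roots of unity -/

/-- If 6c = qp + r with 0 < r < p, then 3c + m = ((q+1)p + r - 1)/2, whose quotient by p is
⌊(q+1)/2⌋. -/
theorem val_three_mul_add {p : ℕ} [Fact p.Prime] (hp : 3 < p) {m : ℕ} (hm : 2 * m + 1 = p)
    {c : ZMod p} (hc : c ≠ 0) :
    (3 * c + m).val + p * ((6 * c.val / p + 1) / 2) = 3 * c.val + m := by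
  have h1 : (3 * c + m).val = (3 * c.val + m) % p := by
    rw [← ZMod.val_natCast, Nat.cast_add, Nat.cast_mul, ZMod.natCast_zmod_val, Nat.cast_ofNat]
  have h6 := sextant_lt c
  have hd := Nat.div_add_mod (6 * c.val) p
  have hlt := Nat.mod_lt (6 * c.val) (show 0 < p by omega)
  have hpos : 0 < 6 * c.val % p :=
    Nat.pos_of_ne_zero fun h => sextant_not_dvd hp hc (Nat.dvd_of_mod_eq_zero h)
  have h2 : (3 * c.val + m) / p = (6 * c.val / p + 1) / 2 := by
    rw [Nat.div_eq_iff (by omega)]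
    generalize 6 * c.val / p = q at *
    interval_cases q <;> omega
  rw [h1, ← h2, Nat.mod_add_div]

theorem sum_quadraticChar_two_mul_add_one {R : Type*} [CommRing R] {p : ℕ} [Fact p.Prime]
    (hp : 3 < p) {m : ℕ} (hm : 2 * m + 1 = p) (f : ℕ → R) :
    ∑ x : ZMod p, (quadraticChar (ZMod p) (2 * x + 1) : R) * f x.val =
      quadraticChar (ZMod p) 6 * ∑ c : ZMod p, (quadraticChar (ZMod p) c : R) *
        f (3 * c.val + m - p * ((6 * c.val / p + 1) / 2)) := by
  obtain ⟨h2, h3⟩ := natCast_two_three_ne_zero hp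
  rw [← ((Equiv.mulLeft₀ ((3 : ℕ) : ZMod p) h3).trans (Equiv.addRight (m : ZMod p))).sum_comp
    fun x => (quadraticChar (ZMod p) (2 * x + 1) : R) * f x.val, Finset.mul_sum]
  refine Finset.sum_congr rfl fun c _ => ?_
  rw [Equiv.trans_apply, Equiv.mulLeft₀_apply, Equiv.coe_addRight, Nat.cast_ofNat]
  have hz : (2 * m + 1 : ZMod p) = 0 := by
    simpa using congrArg (Nat.cast : ℕ → ZMod p) hm
  have e : 2 * (3 * c + m) + 1 = 6 * c := by linear_combination hz
  rw [e, map_mul]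
  rcases eq_or_ne c 0 with rfl | hc
  · simp
  · rw [← val_three_mul_add hp hm hc, Nat.add_sub_cancel]
    push_cast
    ring

theorem pow_sub_mul_eq {R : Type*} [CommRing R] {y : R} (hy : y ^ 3 = 1) {n a r : ℕ}
    (h : a * r ≤ 3 * n + b) : y ^ (3 * n + b - a * r) = y ^ b * (y ^ (2 * a)) ^ r := by
  obtain ⟨d, hd⟩ := Nat.exists_eq_add_of_le h
  have h1 : y ^ (a * r) * y ^ d = y ^ b := by
    rw [← pow_add, ← hd, pow_add, pow_mul, hy, one_pow, one_mul]
  have h2 : y ^ (a * r) * (y ^ (2 * a)) ^ r = 1 := by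
    rw [← pow_mul, ← pow_add, show a * r + 2 * a * r = 3 * (a * r) by ring, pow_mul, hy, one_pow]
  rw [hd, Nat.add_sub_cancel_left, ← h1]
  linear_combination (-y ^ d) * h2

section CubeRoot

variable {R : Type*} [CommRing R] {p : ℕ} [Fact p.Prime] {y : R}

theorem pow_three_eq_one_of_sq_add (hy : y ^ 2 + y + 1 = 0) : y ^ 3 = 1 := by
  linear_combination (y - 1) * hy

theorem pow_sq_add_pow_add_one (hp : 3 < p) (hy : y ^ 2 + y + 1 = 0) :
    (y ^ (2 * p)) ^ 2 + y ^ (2 * p) + 1 = 0 := by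
  have h3 := pow_three_eq_one_of_sq_add hy
  have hmod : p % 3 ≠ 0 := fun h => by
    have := (Nat.prime_dvd_prime_iff_eq Nat.prime_three Fact.out).mp (Nat.dvd_of_mod_eq_zero h)
    omega
  have e : y ^ (2 * p) = y ^ (2 * p % 3) := by
    conv_lhs => rw [← Nat.div_add_mod (2 * p) 3, pow_add, pow_mul, h3, one_pow, one_mul]
  have : 2 * p % 3 = 1 ∨ 2 * p % 3 = 2 := by omega
  rcases this with h | h <;> rw [e, h]
  · linear_combination hy
  · linear_combination hy + y * h3

theorem val_mul_le (hp : 3 < p) {m : ℕ} (hm : 2 * m + 1 = p) {c : ZMod p} (hc : c ≠ 0) :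
    p * ((6 * c.val / p + 1) / 2) ≤ 3 * c.val + m := by
  rw [← val_three_mul_add hp hm hc]
  exact Nat.le_add_left _ _

theorem sum_quadraticChar_mul_cubeRoot_pow (hp : 3 < p) (hp4 : p % 4 = 3) {m : ℕ}
    (hm : 2 * m + 1 = p) (hy : y ^ 2 + y + 1 = 0) :
    ∑ x : ZMod p, (quadraticChar (ZMod p) (2 * x + 1) : R) * y ^ x.val =
      quadraticChar (ZMod p) 6 * y ^ m * (y ^ (2 * p) - (y ^ (2 * p)) ^ 2) *
        ((sextantSum p (quadraticChar (ZMod p)) 1 + sextantSum p (quadraticChar (ZMod p)) 2 : ℤ) :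
          R) := by
  have h3 := pow_three_eq_one_of_sq_add hy
  have hθ := pow_three_eq_one_of_sq_add (pow_sq_add_pow_add_one hp hy)
  have r0 := sextantSum_quadraticChar_reflect hp hp4 (j := 0) (by norm_num)
  have r1 := sextantSum_quadraticChar_reflect hp hp4 (j := 1) (by norm_num)
  have r2 := sextantSum_quadraticChar_reflect hp hp4 (j := 2) (by norm_num)
  have hs := sum_mul_sextant (quadraticChar (ZMod p))
    (fun q => y ^ m * (y ^ (2 * p)) ^ ((q + 1) / 2))
  rw [sum_quadraticChar_two_mul_add_one hp hm (fun n => y ^ n)]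
  have : ∀ c : ZMod p, (quadraticChar (ZMod p) c : R) *
      y ^ (3 * c.val + m - p * ((6 * c.val / p + 1) / 2)) =
      (quadraticChar (ZMod p) c : R) * (y ^ m * (y ^ (2 * p)) ^ ((6 * c.val / p + 1) / 2)) := by
    intro c
    rcases eq_or_ne c 0 with rfl | hc
    · simp
    · rw [pow_sub_mul_eq h3 (val_mul_le hp hm hc)]
  rw [Finset.sum_congr rfl fun c _ => this c, hs]
  generalize y ^ (2 * p) = t at *
  generalize sextantSum p (quadraticChar (ZMod p)) = I at *
  norm_num [Finset.sum_range_succ, -quadraticChar_apply] at r0 r1 r2 ⊢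
  rw [r0, r1, r2]
  push_cast
  -- With θ = y^(2p), the sixths carry weights 1, θ, θ, θ², θ², θ³; reflection leaves I_0(1 - θ³) +
  -- (I_1 + I_2)(θ - θ²).
  linear_combination (-(quadraticChar (ZMod p) 6 : R) * y ^ m * (I 0 : R)) * hθ

theorem sum_quadraticChar_mul_val_mul_cubeRoot_pow (hp : 3 < p) (hp4 : p % 4 = 3)
    (h2 : quadraticChar (ZMod p) 2 = 1) {m : ℕ} (hm : 2 * m + 1 = p) (hy : y ^ 2 + y + 1 = 0) :
    ∑ x : ZMod p, (quadraticChar (ZMod p) (2 * x + 1) : R) * (x.val * y ^ x.val) =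
      quadraticChar (ZMod p) 6 * y ^ m *
        (9 * (sextantSum p (fun x => quadraticChar (ZMod p) x * x.val) 0 : ℤ)) := by
  have h3 := pow_three_eq_one_of_sq_add hy
  have hθ' := pow_sq_add_pow_add_one hp hy
  have hθ := pow_three_eq_one_of_sq_add hθ'
  have r0 := sextantSum_quadraticChar_reflect hp hp4 (j := 0) (by norm_num)
  have r1 := sextantSum_quadraticChar_reflect hp hp4 (j := 1) (by norm_num)
  have r2 := sextantSum_quadraticChar_reflect hp hp4 (j := 2) (by norm_num)
  have t0 := sextantSum_quadraticChar_mul_val_reflect hp hp4 (j := 0) (by norm_num)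
  have t1 := sextantSum_quadraticChar_mul_val_reflect hp hp4 (j := 1) (by norm_num)
  have t2 := sextantSum_quadraticChar_mul_val_reflect hp hp4 (j := 2) (by norm_num)
  have hs := sum_mul_sextant (quadraticChar (ZMod p))
    (fun q => ((m : R) - p * ((q + 1) / 2 : ℕ)) * (y ^ m * (y ^ (2 * p)) ^ ((q + 1) / 2)))
  have hv := sum_mul_sextant (fun x => quadraticChar (ZMod p) x * x.val)
    (fun q => 3 * (y ^ m * (y ^ (2 * p)) ^ ((q + 1) / 2)))
  have hH := sum_mul_sextant (R := ℤ) (fun x : ZMod p => quadraticChar (ZMod p) x * x.val)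
    (fun _ => 1)
  obtain ⟨e1, e2⟩ := sextantSum_relations hp hp4 rfl rfl
  rw [h2] at e1 e2
  rw [sum_quadraticChar_two_mul_add_one hp hm (fun n => (n : R) * y ^ n)]
  have : ∀ c : ZMod p, (quadraticChar (ZMod p) c : R) *
      (((3 * c.val + m - p * ((6 * c.val / p + 1) / 2) : ℕ) : R) *
        y ^ (3 * c.val + m - p * ((6 * c.val / p + 1) / 2))) =
      (quadraticChar (ZMod p) c : R) * (((m : R) - p * ((6 * c.val / p + 1) / 2 : ℕ)) *
        (y ^ m * (y ^ (2 * p)) ^ ((6 * c.val / p + 1) / 2))) +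
      ((quadraticChar (ZMod p) c * c.val : ℤ) : R) *
        (3 * (y ^ m * (y ^ (2 * p)) ^ ((6 * c.val / p + 1) / 2))) := by
    intro c
    rcases eq_or_ne c 0 with rfl | hc
    · simp
    · have hle := val_mul_le hp hm hc
      rw [pow_sub_mul_eq h3 hle, Nat.cast_sub hle]
      push_cast
      ring
  rw [Finset.sum_congr rfl fun c _ => this c, Finset.sum_add_distrib, hs, hv]
  simp only [mul_one, Int.cast_id] at hH
  rw [hH] at e1
  generalize y ^ (2 * p) = t at *
  generalize sextantSum p (quadraticChar (ZMod p)) = I at *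
  generalize sextantSum p (fun x => quadraticChar (ZMod p) x * x.val) = J at *
  have hp0 : (p : ℤ) ≠ 0 := by omega
  have i12 : I 1 + I 2 = 0 := by
    have : (p : ℤ) * (I 1 + I 2) = 0 := by linarith
    exact (mul_eq_zero.mp this).resolve_left hp0
  have i2 : I 2 = -I 1 := by linarith
  norm_num [Finset.sum_range_succ, -quadraticChar_apply] at r0 r1 r2 t0 t1 t2 e1 ⊢
  rw [i2] at e1 t2 r2
  rw [t0, t1, t2] at e1
  -- Reflection gives H = 2(J_0 + J_1 + J_2) - pI_0, and pI_0 = -H when χ(2) = 1. The weighted sum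
  -- 6J_0 - 3(J_1 + J_2) then becomes 9J_0.
  have j2 : J 2 = -J 0 - J 1 := by linarith
  rw [r0, r1, r2, t0, t1, t2, i2, j2]
  push_cast
  linear_combination (quadraticChar (ZMod p) 6 : R) * y ^ m *
    ((3 * (J 0 : R) - m * (I 0 : R)) * hθ - 3 * (J 0 : R) * hθ')

end CubeRoot

/-! ### Multiplicities of cyclotomic factors -/

/-- Expansion preserves division with remainder by a monic polynomial, and remainders are unique. -/
theorem expand_dvd_expand_iff {R : Type*} [CommRing R] {n : ℕ} (hn : 0 < n) {f g : R[X]}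
    (hf : f.Monic) : expand R n f ∣ expand R n g ↔ f ∣ g := by
  refine ⟨fun h => ?_, fun ⟨c, hc⟩ => ⟨expand R n c, by rw [hc, map_mul]⟩⟩
  nontriviality R
  rw [← modByMonic_eq_zero_iff_dvd hf]
  have key := (div_modByMonic_unique (f := expand R n g) (expand R n (g /ₘ f))
    (expand R n (g %ₘ f)) (hf.expand hn) ⟨?_, ?_⟩).2
  · rw [(modByMonic_eq_zero_iff_dvd (hf.expand hn)).mpr h] at key
    exact (expand_eq_zero hn).mp key.symm
  · rw [← map_mul, ← map_add, modByMonic_add_div]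
  · rcases eq_or_ne (g %ₘ f) 0 with h0 | h0
    · rw [h0, map_zero, degree_zero, bot_lt_iff_ne_bot, Ne, degree_eq_bot]
      exact (hf.expand hn).ne_zero
    · refine degree_lt_degree ?_
      rw [natDegree_expand, natDegree_expand]
      exact Nat.mul_lt_mul_of_pos_right
        (natDegree_lt_natDegree h0 (degree_modByMonic_lt g hf)) hn

/-- Φ_12(x) = Φ_6(x²) is coprime to the extra factor x of F_Δ. -/
theorem feketeMult_twelve_eq {Δ : ℤ} (hΔ : Even Δ) :
    feketeMult Δ 12 = modifiedFeketeMult Δ 6 := by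
  have h12 : cyclotomic 12 ℤ = expand ℤ 2 (cyclotomic 6 ℤ) :=
    (cyclotomic_expand_eq_cyclotomic Nat.prime_two (by norm_num : 2 ∣ 6) ℤ).symm
  have hcop : IsCoprime (cyclotomic 12 ℤ) X := by
    rw [h12, cyclotomic_six]
    refine ⟨1, X - X ^ 3, ?_⟩
    simp only [map_add, map_sub, map_pow, map_one, expand_X]
    ring
  rw [feketeMult, modifiedFeketeMult, emultiplicity_eq_emultiplicity_iff]
  intro k
  rw [feketePoly_eq_X_mul_comp hΔ, ← expand_eq_comp_X_pow,
    ← expand_dvd_expand_iff two_pos ((cyclotomic.monic 6 ℤ).pow k), map_pow, ← h12]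
  exact ⟨fun h => hcop.pow_left.dvd_of_dvd_mul_left h, fun h => h.mul_left X⟩

theorem sum_range_eq_sum_zmod {M : Type*} [AddCommMonoid M] {p : ℕ} [NeZero p] (f : ℕ → M) :
    ∑ a ∈ Finset.range p, f a = ∑ x : ZMod p, f x.val := by
  obtain ⟨k, rfl⟩ : ∃ k, p = k + 1 := ⟨p - 1, by have := NeZero.pos p; omega⟩
  exact Finset.sum_range _

/-- The first half of the modified Fekete polynomial of `4 * p`. -/
noncomputable def halfFeketePoly (p : ℕ) [Fact p.Prime] : ℤ[X] :=
  ∑ a ∈ Finset.range p,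
    C ((-1) ^ a * quadraticChar (ZMod p) (2 * (a : ZMod p) + 1)) * X ^ a

/-- Passing from a to a + p keeps χ(2a+1) and flips (-1)^a, as p is odd. -/
theorem modifiedFeketePoly_four_mul_prime {p : ℕ} [Fact p.Prime] (hp : p % 4 = 3) :
    modifiedFeketePoly (4 * (p : ℤ)) = (1 - X ^ p) * halfFeketePoly p := by
  have hodd : Odd p := Nat.odd_iff.mpr (by omega)
  rw [modifiedFeketePoly, show (4 * (p : ℤ)).natAbs / 2 = p + p by omega, Finset.sum_range_add,
    sub_mul, one_mul, halfFeketePoly, Finset.mul_sum, ← Finset.sum_sub_distrib,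
    ← Finset.sum_add_distrib]
  refine Finset.sum_congr rfl fun a _ => ?_
  rw [kroneckerSym_four_mul_prime hp, kroneckerSym_four_mul_prime hp, Nat.cast_add,
    ZMod.natCast_self, zero_add, pow_add (-1), hodd.neg_one_pow, neg_one_mul, neg_mul, C_neg]
  ring

theorem aeval_halfFeketePoly {R : Type*} [CommRing R] {p : ℕ} [Fact p.Prime] (y : R) :
    aeval (-y) (halfFeketePoly p) =
      ∑ x : ZMod p, (quadraticChar (ZMod p) (2 * x + 1) : R) * y ^ x.val := by
  rw [halfFeketePoly, sum_range_eq_sum_zmod, map_sum]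
  refine Finset.sum_congr rfl fun x _ => ?_
  rw [ZMod.natCast_zmod_val, map_mul, aeval_C, map_pow, aeval_X, neg_pow]
  have : ((-1 : R) ^ x.val) * (-1) ^ x.val = 1 := by rw [← mul_pow]; simp
  push_cast [algebraMap_int_eq, eq_intCast]
  linear_combination (quadraticChar (ZMod p) (2 * x + 1) : R) * y ^ x.val * this

theorem aeval_X_mul_derivative_halfFeketePoly {R : Type*} [CommRing R] {p : ℕ} [Fact p.Prime]
    (y : R) :
    aeval (-y) (X * derivative (halfFeketePoly p)) =
      ∑ x : ZMod p, (quadraticChar (ZMod p) (2 * x + 1) : R) * (x.val * y ^ x.val) := by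
  rw [halfFeketePoly, sum_range_eq_sum_zmod, derivative_sum, Finset.mul_sum, map_sum]
  refine Finset.sum_congr rfl fun x _ => ?_
  have e (n : ℕ) : (X : ℤ[X]) * derivative (X ^ n) = C (n : ℤ) * X ^ n := by
    cases n with
    | zero => simp
    | succ n => rw [derivative_X_pow]; simp only [Nat.add_sub_cancel, pow_succ]; push_cast; ring
  rw [ZMod.natCast_zmod_val, derivative_C_mul, mul_left_comm, e, map_mul, C_mul, map_mul, map_mul,
    aeval_C, aeval_C, aeval_C, map_pow, map_pow, aeval_X, neg_pow]
  have : ((-1 : R) ^ x.val) * (-1) ^ x.val = 1 := by rw [← mul_pow]; simp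
  push_cast [algebraMap_int_eq, eq_intCast]
  linear_combination (quadraticChar (ZMod p) (2 * x + 1) : R) * x.val * y ^ x.val * this

theorem halfFeketePoly_three : halfFeketePoly 3 = 1 - X ^ 2 := by
  have h0 : quadraticChar (ZMod 3) (2 * ((0 : ℕ) : ZMod 3) + 1) = 1 := by decide
  have h1 : quadraticChar (ZMod 3) (2 * ((1 : ℕ) : ZMod 3) + 1) = 0 := by decide
  have h2 : quadraticChar (ZMod 3) (2 * ((2 : ℕ) : ZMod 3) + 1) = -1 := by decide
  rw [halfFeketePoly, Finset.sum_range_succ, Finset.sum_range_succ, Finset.sum_range_one, h0, h1,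
    h2]
  simp
  ring

theorem cyclotomic_six_dvd_iff {ζ : ℂ} (hζ : IsPrimitiveRoot ζ 6) {f : ℤ[X]} :
    cyclotomic 6 ℤ ∣ f ↔ aeval ζ f = 0 := by
  rw [cyclotomic_eq_minpoly hζ (by norm_num)]
  exact (minpoly.isIntegrallyClosed_dvd_iff (hζ.isIntegral (by norm_num)) f).symm

theorem modifiedFeketeMult_six_eq {p : ℕ} [Fact p.Prime] (hp : p % 4 = 3) :
    modifiedFeketeMult (4 * (p : ℤ)) 6 = emultiplicity (cyclotomic 6 ℤ) (halfFeketePoly p) := by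
  have hζ := Complex.isPrimitiveRoot_exp 6 (by norm_num)
  have hprime : Prime (cyclotomic 6 ℤ) := (cyclotomic.irreducible (by norm_num)).prime
  have hnd : ¬ cyclotomic 6 ℤ ∣ 1 - X ^ p := by
    rw [cyclotomic_six_dvd_iff hζ]
    simp only [map_sub, map_one, map_pow, aeval_X, sub_eq_zero]
    intro h
    have := hζ.dvd_of_pow_eq_one p h.symm
    omega
  rw [modifiedFeketeMult, modifiedFeketePoly_four_mul_prime hp, emultiplicity_mul hprime,
    emultiplicity_eq_zero.mpr hnd, zero_add]

theorem IsPrimitiveRoot.six_neg_sq_add {ζ : ℂ} (hζ : IsPrimitiveRoot ζ 6) :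
    (-ζ) ^ 2 + -ζ + 1 = 0 := by
  have h := (cyclotomic_six_dvd_iff hζ).mp dvd_rfl
  rw [cyclotomic_six] at h
  simp only [map_add, map_sub, map_pow, map_one, aeval_X] at h
  linear_combination h

theorem quadraticChar_six_ne_zero {p : ℕ} [Fact p.Prime] (hp : 3 < p) :
    (quadraticChar (ZMod p) 6 : ℂ) ≠ 0 := by
  obtain ⟨h2, h3⟩ := natCast_two_three_ne_zero hp
  rw [Int.cast_ne_zero, Ne, quadraticChar_eq_zero_iff]
  have := mul_ne_zero h2 h3
  norm_num at this ⊢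
  exact this

theorem aeval_halfFeketePoly_eq_zero_iff {p : ℕ} [Fact p.Prime] (hp : 3 < p) (hp4 : p % 4 = 3)
    {ζ : ℂ} (hζ : IsPrimitiveRoot ζ 6) :
    aeval ζ (halfFeketePoly p) = 0 ↔ quadraticChar (ZMod p) 2 = 1 := by
  obtain ⟨m, hm⟩ : ∃ m, 2 * m + 1 = p := ⟨p / 2, by omega⟩
  obtain ⟨h2, h3⟩ := natCast_two_three_ne_zero hp
  have hy := hζ.six_neg_sq_add
  have hy0 : -ζ ≠ 0 := neg_ne_zero.mpr (hζ.ne_zero (by norm_num))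
  have hθ := pow_sq_add_pow_add_one hp hy
  have h6 := quadraticChar_six_ne_zero hp
  have ht : ((-ζ) ^ (2 * p) - ((-ζ) ^ (2 * p)) ^ 2) ≠ 0 := by
    intro h
    have hd : (-ζ) ^ (2 * p) * (1 - (-ζ) ^ (2 * p)) = 0 := by linear_combination h
    rcases mul_eq_zero.mp hd with h' | h'
    · exact pow_ne_zero _ hy0 h'
    · rw [← sub_eq_zero.mp h'] at hθ
      norm_num at hθ
  have hH := sum_quadraticChar_mul_val_odd hp4
  obtain ⟨-, e⟩ := sextantSum_relations hp hp4 rfl rfl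
  rw [← neg_neg ζ, aeval_halfFeketePoly, sum_quadraticChar_mul_cubeRoot_pow hp hp4 hm hy,
    mul_eq_zero_iff_left (mul_ne_zero (mul_ne_zero h6 (pow_ne_zero _ hy0)) ht), Int.cast_eq_zero]
  have hH0 : ∑ x : ZMod p, quadraticChar (ZMod p) x * (x.val : ℤ) ≠ 0 := by
    intro h; rw [h] at hH; simp at hH
  have q3 : 3 - quadraticChar (ZMod p) 3 ≠ 0 := by
    rcases quadraticChar_dichotomy h3 with h | h <;> rw [Nat.cast_ofNat] at h <;> rw [h] <;>
      norm_num
  have hp0 : (p : ℤ) ≠ 0 := by omega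
  constructor
  · intro h
    rw [h, mul_zero, mul_zero, eq_comm, mul_eq_zero_iff_right hH0, mul_eq_zero_iff_left q3] at e
    linarith
  · intro h
    rw [h, sub_self, mul_zero, zero_mul] at e
    exact (mul_eq_zero_iff_left hp0).mp ((mul_eq_zero_iff_left two_ne_zero).mp e)

theorem not_cyclotomic_six_sq_dvd_halfFeketePoly {p : ℕ} [Fact p.Prime] (hp : 3 < p)
    (hp4 : p % 4 = 3) (h2 : quadraticChar (ZMod p) 2 = 1) :
    ¬ cyclotomic 6 ℤ ^ 2 ∣ halfFeketePoly p := by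
  intro hdvd
  have hζ := Complex.isPrimitiveRoot_exp 6 (by norm_num)
  set ζ := Complex.exp (2 * Real.pi * Complex.I / (6 : ℕ))
  obtain ⟨m, hm⟩ : ∃ m, 2 * m + 1 = p := ⟨p / 2, by omega⟩
  have hy := hζ.six_neg_sq_add
  have hy0 : -ζ ≠ 0 := neg_ne_zero.mpr (hζ.ne_zero (by norm_num))
  have h6 := quadraticChar_six_ne_zero hp
  -- A double root would also be a root of Xh'; the factor X keeps the exponents equal to those of
  -- h.
  have hder : aeval ζ (X * derivative (halfFeketePoly p)) = 0 := by
    obtain ⟨g, hg⟩ := hdvd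
    rw [← cyclotomic_six_dvd_iff hζ, hg, derivative_mul, derivative_pow]
    exact Dvd.intro (X * (2 * derivative (cyclotomic 6 ℤ) * g +
      cyclotomic 6 ℤ * derivative g)) (by simp; ring)
  rw [← neg_neg ζ, aeval_X_mul_derivative_halfFeketePoly,
    sum_quadraticChar_mul_val_mul_cubeRoot_pow hp hp4 h2 hm hy,
    mul_eq_zero_iff_left (mul_ne_zero h6 (pow_ne_zero _ hy0)),
    mul_eq_zero_iff_left (by norm_num), Int.cast_eq_zero] at hder
  refine sextantSum_quadraticChar_mul_val_zero_ne_zero hp hp4 ?_ hder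
  obtain ⟨e1, e2⟩ := sextantSum_relations hp hp4 rfl rfl
  rw [h2] at e1 e2
  linarith

theorem mainTheorem7 (p : ℕ) (hp : p.Prime) (hp4 : p ≡ 3 [MOD 4]) :
    feketeMult (4 * (p : ℤ)) 12 = modifiedFeketeMult (4 * (p : ℤ)) 6 ∧
    (p ≡ 7 [MOD 8] → feketeMult (4 * (p : ℤ)) 12 = 1) ∧
    (p ≡ 3 [MOD 8] → feketeMult (4 * (p : ℤ)) 12 = 0) := by
  have : Fact p.Prime := ⟨hp⟩
  have hp4' : p % 4 = 3 := hp4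
  have hζ := Complex.isPrimitiveRoot_exp 6 (by norm_num)
  have htwo : quadraticChar (ZMod p) 2 = if p % 8 = 7 then 1 else -1 := by
    rw [quadraticChar_two (by rw [ZMod.ringChar_zmod_n]; omega), ZMod.card,
      ZMod.χ₈_nat_eq_if_mod_eight, if_neg (by omega)]
    exact if_congr (by omega) rfl rfl
  refine ⟨feketeMult_twelve_eq ⟨2 * p, by ring⟩, fun h => ?_, fun h => ?_⟩ <;>
    rw [feketeMult_twelve_eq ⟨2 * p, by ring⟩, modifiedFeketeMult_six_eq hp4']
  · have h7 : p % 8 = 7 := h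
    rw [if_pos h7] at htwo
    have hp3 : 3 < p := by omega
    refine emultiplicity_eq_coe.mpr ⟨?_, not_cyclotomic_six_sq_dvd_halfFeketePoly hp3 hp4' htwo⟩
    rw [pow_one, cyclotomic_six_dvd_iff hζ]
    exact (aeval_halfFeketePoly_eq_zero_iff hp3 hp4' hζ).mpr htwo
  · have h3 : p % 8 = 3 := h
    rw [if_neg (by omega)] at htwo
    rw [emultiplicity_eq_zero, cyclotomic_six_dvd_iff hζ]
    -- For p = 3 the substitution by 3c is not invertible; there h = 1 - X² is checked directly.
    rcases eq_or_ne p 3 with rfl | hp3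
    · rw [halfFeketePoly_three, map_sub, map_one, map_pow, aeval_X, sub_eq_zero]
      intro h
      have := hζ.dvd_of_pow_eq_one 2 h.symm
      omega
    · rw [aeval_halfFeketePoly_eq_zero_iff (by omega) hp4' hζ, htwo]
      norm_num
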